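/- For $n\in\mathbb N$ and a real number $0<s\le n$ let $$S_{n,s}=\{x\in\mathbb R^n:\ \|x\|_0\le s,\ \|x\|_2\le 1\},$$ where $\|x\|_0$ is the number of nonzero entries of $x$ and $\|x\|_2$ is the Euclidean norm. For $K\subseteq\mathbb R^n$ let $$w(K)=\mathbb E\sup_{x\in K-K}\langle g,x\rangle,\qquad K-K=\{x-y:\ x,y\in K\},$$ be the Gaussian mean width, where $g$ is a standard normal random vector in $\mathbb R^n$. There exist absolute constants $c,C>0$ such that for all $n\in\mathbb N$ and all real $s$ with $0<s\le n$ the expectation defining $w(S_{n,s})$ is finite and $$w(S_{n,s})^2\le C\,s\log(2n/s),$$ and, if moreover $s\ge 1$, $$c\,s\log(2n/s)\le w(S_{n,s})^2 .$$ -/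

import Mathlib

/-!
For the upper bound, Cauchy–Schwarz bounds `⟨g, x⟩²` by the sum of `g i ^ 2` over the support of
`x`. To avoid a union bound over supports, each `y = g i ^ 2 / 4` is replaced by the larger
`log L + exp y / L` with `L = 2n / s`: the first term is summed over the at most `s` coordinates of
the support, the second over all `n` coordinates, and `𝔼 exp (g i ^ 2 / 4) = √2`.

For the lower bound, choose `⌊s⌋` disjoint blocks of `⌊n / ⌊s⌋⌋` coordinates and let `x` have the
entry `± 1 / √⌊s⌋` at the coordinate of largest modulus of `g` in each block, with the sign of `g`
there. The largest modulus among `k` independent standard Gaussians has mean of order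
`√(log (2k))`, since it exceeds this level with probability bounded below.
-/

open MeasureTheory ProbabilityTheory
open scoped Pointwise

/-- The width functional of a set `K ⊆ ℝⁿ` in direction `g`: the supremum of `⟨g, x⟩` over the
Minkowski difference `K - K`. (The supremum is a real supremum; it is the genuine one whenever `K`
is nonempty and bounded, see `bddAbove_inner_image_sub`.) -/
noncomputable def widthAlong {n : ℕ} (K : Set (EuclideanSpace ℝ (Fin n)))
    (g : EuclideanSpace ℝ (Fin n)) : ℝ :=
  sSup ((fun x => inner ℝ g x) '' (K - K))

/-- The Gaussian mean width `w(K) = 𝔼 sup_{x ∈ K - K} ⟨g, x⟩`, with `g` a standard normal random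
vector in `ℝⁿ`. -/
noncomputable def gaussianMeanWidth {n : ℕ} (K : Set (EuclideanSpace ℝ (Fin n))) : ℝ :=
  ∫ g, widthAlong K g ∂(stdGaussian (EuclideanSpace ℝ (Fin n)))

/-- The set `S_{n,s}` of vectors in `ℝⁿ` with at most `s` nonzero entries (`s` real) and with
Euclidean norm at most `1`. -/
def sparseSignalSet (n : ℕ) (s : ℝ) : Set (EuclideanSpace ℝ (Fin n)) :=
  {x | (hammingNorm (WithLp.ofLp x) : ℝ) ≤ s ∧ ‖x‖ ≤ 1}

theorem bddAbove_inner_image_sub {n : ℕ} {K : Set (EuclideanSpace ℝ (Fin n))}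
    (hK : Bornology.IsBounded K) (g : EuclideanSpace ℝ (Fin n)) :
    BddAbove ((fun x => inner ℝ g x) '' (K - K)) := by
  obtain ⟨R, hR⟩ := (hK.sub hK).exists_norm_le
  refine ⟨‖g‖ * R, ?_⟩
  rintro _ ⟨x, hx, rfl⟩
  exact (real_inner_le_norm g x).trans (mul_le_mul_of_nonneg_left (hR x hx) (norm_nonneg g))

theorem sparseSignalSet_isBounded (n : ℕ) (s : ℝ) :
    Bornology.IsBounded (sparseSignalSet n s) :=
  isBounded_iff_forall_norm_le.2 ⟨1, fun _ hx => hx.2⟩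

section Width

variable {n : ℕ} {K : Set (EuclideanSpace ℝ (Fin n))} {g x y : EuclideanSpace ℝ (Fin n)} {B : ℝ}

lemma widthAlong_le (hB : 0 ≤ B) (h : ∀ x ∈ K, ∀ y ∈ K, inner ℝ g (x - y) ≤ B) :
    widthAlong K g ≤ B := by
  refine Real.sSup_le ?_ hB
  rintro _ ⟨_, ⟨x, hx, y, hy, rfl⟩, rfl⟩
  exact h x hx y hy

lemma inner_sub_le_widthAlong (hK : Bornology.IsBounded K) (hx : x ∈ K) (hy : y ∈ K) :
    inner ℝ g (x - y) ≤ widthAlong K g :=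
  le_csSup (bddAbove_inner_image_sub hK g) ⟨_, Set.sub_mem_sub hx hy, rfl⟩

lemma two_mul_inner_le_widthAlong (hK : Bornology.IsBounded K) (hx : x ∈ K) (hx' : -x ∈ K) :
    2 * inner ℝ g x ≤ widthAlong K g := by
  have h := inner_sub_le_widthAlong (g := g) hK hx hx'
  rwa [sub_neg_eq_add, inner_add_right, ← two_mul] at h

-- The real supremum of an empty or unbounded set is `0`.
lemma widthAlong_nonneg (K : Set (EuclideanSpace ℝ (Fin n))) (g : EuclideanSpace ℝ (Fin n)) :
    0 ≤ widthAlong K g := by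
  obtain rfl | ⟨x, hx⟩ := K.eq_empty_or_nonempty
  · simp [widthAlong]
  · exact Real.sSup_nonneg' ⟨0, ⟨0, ⟨x, hx, x, hx, sub_self x⟩, inner_zero_right g⟩, le_rfl⟩

lemma widthAlong_sq_le (hB : 0 ≤ B) (h : ∀ x ∈ K, inner ℝ g x ^ 2 ≤ B) :
    widthAlong K g ^ 2 ≤ 4 * B := by
  have hwidth : widthAlong K g ≤ 2 * √B := by
    refine widthAlong_le (by positivity) fun x hx y hy => ?_
    have hx' := abs_le.1 (Real.abs_le_sqrt (h x hx))
    have hy' := abs_le.1 (Real.abs_le_sqrt (h y hy))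
    rw [inner_sub_right]
    linarith
  calc widthAlong K g ^ 2 ≤ (2 * √B) ^ 2 := pow_le_pow_left₀ (widthAlong_nonneg K g) hwidth 2
    _ = 4 * B := by rw [mul_pow, Real.sq_sqrt hB]; norm_num

lemma lipschitzWith_widthAlong (hK : Bornology.IsBounded K) :
    LipschitzWith ⟨Metric.diam K, Metric.diam_nonneg⟩ (widthAlong K) := by
  refine LipschitzWith.of_le_add_mul _ fun g h => ?_
  have hdiam : 0 ≤ Metric.diam K := Metric.diam_nonneg
  refine widthAlong_le (add_nonneg (widthAlong_nonneg K h) (by positivity)) fun x hx y hy => ?_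
  calc inner ℝ g (x - y) = inner ℝ h (x - y) + inner ℝ (g - h) (x - y) := by
        rw [← inner_add_left, add_sub_cancel]
    _ ≤ widthAlong K h + ‖g - h‖ * ‖x - y‖ :=
        add_le_add (inner_sub_le_widthAlong hK hx hy) (real_inner_le_norm _ _)
    _ ≤ widthAlong K h + Metric.diam K * dist g h := by
        rw [← dist_eq_norm, ← dist_eq_norm, mul_comm]
        gcongr
        exact Metric.dist_le_diam_of_mem hK hx hy

lemma memLp_widthAlong (hK : Bornology.IsBounded K) {p : ENNReal} (hp : p ≠ ⊤) :
    MemLp (widthAlong K) p (stdGaussian (EuclideanSpace ℝ (Fin n))) :=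
  (lipschitzWith_widthAlong hK).comp_memLp
    (le_antisymm (widthAlong_le le_rfl (by simp)) (widthAlong_nonneg K 0))
    (IsGaussian.memLp_id _ p hp)

lemma integrable_widthAlong (hK : Bornology.IsBounded K) :
    Integrable (widthAlong K) (stdGaussian (EuclideanSpace ℝ (Fin n))) :=
  (memLp_widthAlong hK ENNReal.one_ne_top).integrable le_rfl

lemma gaussianMeanWidth_sq_le_integral_sq (hK : Bornology.IsBounded K) :
    gaussianMeanWidth K ^ 2 ≤
      ∫ g, widthAlong K g ^ 2 ∂(stdGaussian (EuclideanSpace ℝ (Fin n))) :=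
  (even_two.convexOn_pow (𝕜 := ℝ)).map_integral_le (continuous_pow 2).continuousOn isClosed_univ
    (ae_of_all _ fun _ => Set.mem_univ _) (integrable_widthAlong hK)
    (memLp_widthAlong hK ENNReal.ofNat_ne_top).integrable_sq

end Width

section GaussianReal

open scoped NNReal

lemma gaussianPDFReal_mul_exp_mul_sq {v : ℝ≥0} (hv : v ≠ 0) (a x : ℝ) :
    gaussianPDFReal 0 v x * Real.exp (a * x ^ 2) =
      (√(2 * Real.pi * v))⁻¹ * Real.exp (-((1 - 2 * a * v) / (2 * v)) * x ^ 2) := by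
  rw [gaussianPDFReal, mul_assoc, ← Real.exp_add]
  congr 2
  field_simp
  ring

lemma integrable_exp_mul_sq_gaussianReal {v : ℝ≥0} {a : ℝ} (h : 2 * a * v < 1) :
    Integrable (fun x => Real.exp (a * x ^ 2)) (gaussianReal 0 v) := by
  obtain rfl | hv := eq_or_ne v 0
  · simpa using integrable_dirac (by simp)
  rw [gaussianReal_of_var_ne_zero _ hv, integrable_withDensity_iff_integrable_smul'
    (measurable_gaussianPDF _ _) (ae_of_all _ fun _ => gaussianPDF_lt_top)]
  simp only [toReal_gaussianPDF, smul_eq_mul, gaussianPDFReal_mul_exp_mul_sq hv]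
  exact (integrable_exp_neg_mul_sq (div_pos (sub_pos.2 h) (by positivity))).const_mul _

-- When `1 ≤ 2 * a * v`, both sides are the junk value `0`.
lemma integral_exp_mul_sq_gaussianReal {v : ℝ≥0} {a : ℝ} :
    ∫ x, Real.exp (a * x ^ 2) ∂(gaussianReal 0 v) = (√(1 - 2 * a * v))⁻¹ := by
  obtain rfl | hv := eq_or_ne v 0
  · simp
  simp only [integral_gaussianReal_eq_integral_smul hv, smul_eq_mul,
    gaussianPDFReal_mul_exp_mul_sq hv]
  rw [integral_const_mul, integral_gaussian, ← Real.sqrt_inv, ← Real.sqrt_inv,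
    ← Real.sqrt_mul (by positivity)]
  congr 1
  field_simp

lemma le_gaussianReal_real_Ici (τ : ℝ) :
    (√(2 * Real.pi))⁻¹ * Real.exp (-1) * Real.exp (-τ ^ 2) ≤
      (gaussianReal 0 1).real (Set.Ici τ) := by
  have hpdf : ∀ x ∈ Set.Icc τ (τ + 1),
      (√(2 * Real.pi))⁻¹ * Real.exp (-1) * Real.exp (-τ ^ 2) ≤ gaussianPDFReal 0 1 x := by
    rintro x ⟨hτx, hxτ⟩
    have hx : x ^ 2 ≤ 2 * τ ^ 2 + 2 := by nlinarith [sq_nonneg (2 * τ - x)]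
    rw [gaussianPDFReal, mul_assoc, ← Real.exp_add]
    simp only [NNReal.coe_one, mul_one, sub_zero]
    gcongr
    linarith
  calc (√(2 * Real.pi))⁻¹ * Real.exp (-1) * Real.exp (-τ ^ 2)
      ≤ ∫ x in Set.Icc τ (τ + 1), gaussianPDFReal 0 1 x := by
        simpa using setIntegral_ge_of_const_le_real (μ := volume) measurableSet_Icc (by simp) hpdf
          (integrable_gaussianPDFReal 0 1).integrableOn
    _ = (gaussianReal 0 1).real (Set.Icc τ (τ + 1)) := by
        rw [measureReal_def, gaussianReal_apply_eq_integral _ one_ne_zero,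
          ENNReal.toReal_ofReal (integral_nonneg fun _ => gaussianPDFReal_nonneg _ _ _)]
    _ ≤ (gaussianReal 0 1).real (Set.Ici τ) := measureReal_mono Set.Icc_subset_Ici_self

end GaussianReal

section MaximumOfIndependent

lemma setOf_le_norm_eq_compl_ball {E : Type*} [SeminormedAddCommGroup E] (τ : ℝ) :
    {x : E | τ ≤ ‖x‖} = (Metric.ball 0 τ)ᶜ := by
  ext
  simp

variable {κ : Type*} [Fintype κ]

lemma one_sub_exp_le_pi_real_norm_ge {E : Type*} [NormedAddCommGroup E] [MeasurableSpace E]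
    [OpensMeasurableSpace E] (μ : Measure E) [IsProbabilityMeasure μ] {τ : ℝ} (hτ : 0 < τ) :
    1 - Real.exp (-(Fintype.card κ * μ.real {x | τ ≤ ‖x‖})) ≤
      (Measure.pi fun _ : κ => μ).real {x | τ ≤ ‖x‖} := by
  have hball : MeasurableSet (Metric.ball (0 : κ → E) τ) := by
    rw [ball_pi _ hτ]
    exact .univ_pi fun _ => measurableSet_ball
  have hpi : (Measure.pi fun _ : κ => μ).real (Metric.ball 0 τ) =
      (1 - μ.real {x | τ ≤ ‖x‖}) ^ Fintype.card κ := by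
    rw [setOf_le_norm_eq_compl_ball, probReal_compl_eq_one_sub measurableSet_ball, sub_sub_cancel,
      measureReal_def, Measure.pi_ball _ _ hτ]
    simp [measureReal_def]
  rw [setOf_le_norm_eq_compl_ball (E := κ → E), probReal_compl_eq_one_sub hball, hpi]
  gcongr
  calc (1 - μ.real {x | τ ≤ ‖x‖}) ^ Fintype.card κ
      ≤ Real.exp (-μ.real {x | τ ≤ ‖x‖}) ^ Fintype.card κ :=
        pow_le_pow_left₀ (sub_nonneg.2 measureReal_le_one) (Real.one_sub_le_exp_neg _) _
    _ = Real.exp (-(Fintype.card κ * μ.real {x | τ ≤ ‖x‖})) := by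
        rw [← Real.exp_nat_mul, mul_neg]

/-- An absolute lower bound for the probability that some coordinate of a standard Gaussian vector
in `ℝᵏ` has modulus at least `√(log (2k))`; the constant in the exponent is half the one in
`le_gaussianReal_real_Ici`. -/
noncomputable def gaussianMaxConst : ℝ :=
  1 - Real.exp (-((√(2 * Real.pi))⁻¹ * Real.exp (-1) / 2))

lemma gaussianMaxConst_pos : 0 < gaussianMaxConst := by
  rw [gaussianMaxConst, sub_pos, Real.exp_lt_one_iff, neg_lt_zero]
  positivity

lemma gaussianMaxConst_le_pi_real_norm_ge [Nonempty κ] :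
    gaussianMaxConst ≤ (Measure.pi fun _ : κ => gaussianReal 0 1).real
      {x | √(Real.log (2 * Fintype.card κ)) ≤ ‖x‖} := by
  set τ := √(Real.log (2 * Fintype.card κ))
  have hk : (1 : ℝ) ≤ Fintype.card κ := by exact_mod_cast Fintype.card_pos (α := κ)
  have hlog : 0 < Real.log (2 * Fintype.card κ) := Real.log_pos (by linarith)
  refine le_trans ?_ (one_sub_exp_le_pi_real_norm_ge _ (Real.sqrt_pos.2 hlog))
  have hexp : Real.exp (-τ ^ 2) = (2 * (Fintype.card κ : ℝ))⁻¹ := by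
    rw [Real.sq_sqrt hlog.le, Real.exp_neg, Real.exp_log (by linarith)]
  have htail : (√(2 * Real.pi))⁻¹ * Real.exp (-1) * (2 * (Fintype.card κ : ℝ))⁻¹ ≤
      (gaussianReal 0 1).real {x | τ ≤ ‖x‖} :=
    hexp ▸ (le_gaussianReal_real_Ici τ).trans
      (measureReal_mono fun x (hx : τ ≤ x) => hx.trans (le_abs_self x))
  rw [gaussianMaxConst]
  gcongr
  calc (√(2 * Real.pi))⁻¹ * Real.exp (-1) / 2
      = Fintype.card κ * ((√(2 * Real.pi))⁻¹ * Real.exp (-1) * (2 * (Fintype.card κ : ℝ))⁻¹) := by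
        field_simp
    _ ≤ _ := by gcongr

lemma integrable_norm_pi_gaussianReal :
    Integrable (fun x : κ → ℝ => ‖x‖) (Measure.pi fun _ : κ => gaussianReal 0 1) :=
  (Integrable.of_eval fun _ => integrable_eval IsGaussian.integrable_id).norm

lemma mul_sqrt_log_le_integral_norm_pi_gaussianReal [Nonempty κ] :
    gaussianMaxConst * √(Real.log (2 * Fintype.card κ)) ≤
      ∫ x, ‖x‖ ∂(Measure.pi fun _ : κ => gaussianReal 0 1) := by
  refine le_trans ?_ (mul_meas_ge_le_integral_of_nonneg (ae_of_all _ fun x => norm_nonneg x)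
    integrable_norm_pi_gaussianReal √(Real.log (2 * Fintype.card κ)))
  rw [mul_comm]
  gcongr
  exact gaussianMaxConst_le_pi_real_norm_ge

end MaximumOfIndependent

section StdGaussian

variable {ι κ : Type*} [Fintype ι] [Fintype κ]

lemma measurePreserving_pi_comp_injective {α : ι → Type*} [∀ i, MeasurableSpace (α i)]
    (μ : ∀ i, Measure (α i)) [∀ i, IsProbabilityMeasure (μ i)] {e : κ → ι}
    (he : Function.Injective e) :
    MeasurePreserving (fun (x : ∀ i, α i) j => x (e j)) (Measure.pi μ)
      (Measure.pi fun j => μ (e j)) := by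
  refine ⟨by fun_prop, ?_⟩
  have hindep := (iIndepFun_pi (μ := μ) (X := fun _ => id) fun _ => aemeasurable_id).precomp he
  refine ((iIndepFun_iff_map_fun_eq_pi_map fun _ => (measurable_pi_apply _).aemeasurable).1
    hindep).trans ?_
  exact congrArg Measure.pi (funext fun j => (measurePreserving_eval μ (e j)).map_eq)

lemma measurePreserving_ofLp_stdGaussian :
    MeasurePreserving (WithLp.ofLp : EuclideanSpace ℝ ι → ι → ℝ)
      (stdGaussian (EuclideanSpace ℝ ι)) (Measure.pi fun _ => gaussianReal 0 1) := by
  refine ⟨by fun_prop, ?_⟩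
  rw [← map_pi_eq_stdGaussian, Measure.map_map (by fun_prop) (by fun_prop)]
  exact Measure.map_id

lemma measurePreserving_eval_stdGaussian (i : ι) :
    MeasurePreserving (fun g : EuclideanSpace ℝ ι => g i)
      (stdGaussian (EuclideanSpace ℝ ι)) (gaussianReal 0 1) :=
  (measurePreserving_eval _ i).comp measurePreserving_ofLp_stdGaussian

lemma measurePreserving_comp_stdGaussian {e : κ → ι} (he : Function.Injective e) :
    MeasurePreserving (fun (g : EuclideanSpace ℝ ι) j => g (e j))
      (stdGaussian (EuclideanSpace ℝ ι)) (Measure.pi fun _ => gaussianReal 0 1) :=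
  (measurePreserving_pi_comp_injective _ he).comp measurePreserving_ofLp_stdGaussian

lemma integrable_exp_mul_sq_eval_stdGaussian {a : ℝ} (ha : 2 * a < 1) (i : ι) :
    Integrable (fun g : EuclideanSpace ℝ ι => Real.exp (a * g i ^ 2))
      (stdGaussian (EuclideanSpace ℝ ι)) :=
  (measurePreserving_eval_stdGaussian i).integrable_comp_of_integrable
    (integrable_exp_mul_sq_gaussianReal (by simpa using ha))

lemma integral_sum_exp_mul_sq_stdGaussian {a : ℝ} (ha : 2 * a < 1) :
    ∫ g : EuclideanSpace ℝ ι, ∑ i, Real.exp (a * g i ^ 2) ∂(stdGaussian (EuclideanSpace ℝ ι)) =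
      Fintype.card ι * (√(1 - 2 * a))⁻¹ := by
  have hcoord (i : ι) : ∫ g : EuclideanSpace ℝ ι, Real.exp (a * g i ^ 2)
      ∂(stdGaussian (EuclideanSpace ℝ ι)) = (√(1 - 2 * a))⁻¹ := by
    have h := integral_exp_mul_sq_gaussianReal (v := 1) (a := a)
    rw [← (measurePreserving_eval_stdGaussian i).map_eq,
      integral_map (by fun_prop) (by fun_prop)] at h
    simpa using h
  rw [integral_finsetSum _ fun i _ => integrable_exp_mul_sq_eval_stdGaussian ha i]
  simp [hcoord]

lemma mul_sqrt_log_le_integral_norm_comp_stdGaussian [Nonempty κ] {e : κ → ι}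
    (he : Function.Injective e) :
    gaussianMaxConst * √(Real.log (2 * Fintype.card κ)) ≤
      ∫ g : EuclideanSpace ℝ ι, ‖fun j => g (e j)‖ ∂(stdGaussian (EuclideanSpace ℝ ι)) := by
  have h := mul_sqrt_log_le_integral_norm_pi_gaussianReal (κ := κ)
  rwa [← (measurePreserving_comp_stdGaussian he).map_eq,
    integral_map (by fun_prop) (by fun_prop)] at h

lemma integrable_norm_comp_stdGaussian {e : κ → ι} (he : Function.Injective e) :
    Integrable (fun g : EuclideanSpace ℝ ι => ‖fun j => g (e j)‖)
      (stdGaussian (EuclideanSpace ℝ ι)) :=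
  (measurePreserving_comp_stdGaussian he).integrable_comp_of_integrable
    integrable_norm_pi_gaussianReal

end StdGaussian

section UpperBound

lemma inner_sq_le_sum_support_mul_norm_sq {ι : Type*} [Fintype ι] (g x : EuclideanSpace ℝ ι) :
    (inner ℝ g x : ℝ) ^ 2 ≤ (∑ i with x i ≠ 0, g i ^ 2) * ‖x‖ ^ 2 := by
  have hsupport {f : ι → ℝ} (hf : ∀ i, x i = 0 → f i = 0) : ∑ i with x i ≠ 0, f i = ∑ i, f i :=
    Finset.sum_filter_of_ne fun i _ hi => mt (hf i) hi
  calc (inner ℝ g x : ℝ) ^ 2 = (∑ i with x i ≠ 0, g i * x i) ^ 2 := by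
        rw [hsupport fun i hi => by simp [hi], PiLp.inner_apply]
        simp [mul_comm]
    _ ≤ (∑ i with x i ≠ 0, g i ^ 2) * ∑ i with x i ≠ 0, x i ^ 2 :=
        Finset.sum_mul_sq_le_sq_mul_sq _ _ _
    _ = (∑ i with x i ≠ 0, g i ^ 2) * ‖x‖ ^ 2 := by
        rw [hsupport (f := fun i => x i ^ 2) fun i hi => by simp [hi],
          EuclideanSpace.real_norm_sq_eq]

lemma le_log_add_exp_div {L : ℝ} (hL : 0 < L) (y : ℝ) :
    y ≤ Real.log L + Real.exp y / L := by
  have h := Real.add_one_le_exp (y - Real.log L)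
  rw [Real.exp_sub, Real.exp_log hL] at h
  linarith

variable {n : ℕ} {s L : ℝ}

lemma inner_sq_le_of_mem_sparseSignalSet (hL : 1 ≤ L) (g : EuclideanSpace ℝ (Fin n))
    {x : EuclideanSpace ℝ (Fin n)} (hx : x ∈ sparseSignalSet n s) :
    inner ℝ g x ^ 2 ≤ 4 * (s * Real.log L + (∑ i, Real.exp (1 / 4 * g i ^ 2)) / L) := by
  have hL0 : 0 < L := one_pos.trans_le hL
  calc inner ℝ g x ^ 2 ≤ (∑ i with x i ≠ 0, g i ^ 2) * ‖x‖ ^ 2 :=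
        inner_sq_le_sum_support_mul_norm_sq g x
    _ ≤ ∑ i with x i ≠ 0, g i ^ 2 :=
        mul_le_of_le_one_right (by positivity) (pow_le_one₀ (norm_nonneg x) hx.2)
    _ ≤ ∑ i with x i ≠ 0, 4 * (Real.log L + Real.exp (1 / 4 * g i ^ 2) / L) := by
        gcongr with i
        linarith [le_log_add_exp_div hL0 (1 / 4 * g i ^ 2)]
    _ = 4 * (hammingNorm (WithLp.ofLp x) * Real.log L +
          (∑ i with x i ≠ 0, Real.exp (1 / 4 * g i ^ 2)) / L) := by
        rw [← Finset.mul_sum, Finset.sum_add_distrib, Finset.sum_const, nsmul_eq_mul,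
          ← Finset.sum_div]
        rfl
    _ ≤ 4 * (s * Real.log L + (∑ i, Real.exp (1 / 4 * g i ^ 2)) / L) := by
        gcongr
        · exact Real.log_nonneg hL
        · exact hx.1
        · exact Finset.filter_subset _ _

lemma gaussianMeanWidth_sparseSignalSet_sq_le_add (hs : 0 ≤ s) (hL : 1 ≤ L) :
    gaussianMeanWidth (sparseSignalSet n s) ^ 2 ≤ 16 * (s * Real.log L + n * √2 / L) := by
  have hint : Integrable (fun g : EuclideanSpace ℝ (Fin n) => ∑ i, Real.exp (1 / 4 * g i ^ 2))
      (stdGaussian (EuclideanSpace ℝ (Fin n))) :=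
    integrable_finsetSum _ fun i _ => integrable_exp_mul_sq_eval_stdGaussian (by norm_num) i
  have hsqrt : (√(1 - 2 * (1 / 4)))⁻¹ = √2 := by rw [← Real.sqrt_inv]; norm_num
  have hlog : 0 ≤ Real.log L := Real.log_nonneg hL
  calc gaussianMeanWidth (sparseSignalSet n s) ^ 2
      ≤ ∫ g, widthAlong (sparseSignalSet n s) g ^ 2 ∂(stdGaussian (EuclideanSpace ℝ (Fin n))) :=
        gaussianMeanWidth_sq_le_integral_sq (sparseSignalSet_isBounded n s)
    _ ≤ ∫ g : EuclideanSpace ℝ (Fin n),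
          4 * (4 * (s * Real.log L + (∑ i, Real.exp (1 / 4 * g i ^ 2)) / L))
          ∂(stdGaussian (EuclideanSpace ℝ (Fin n))) :=
        integral_mono
          (memLp_widthAlong (sparseSignalSet_isBounded n s) ENNReal.ofNat_ne_top).integrable_sq
          ((((integrable_const _).add (hint.div_const L)).const_mul 4).const_mul 4)
          fun g => widthAlong_sq_le (by positivity)
            fun x hx => inner_sq_le_of_mem_sparseSignalSet hL g hx
    _ = 16 * (s * Real.log L + n * √2 / L) := by
        rw [integral_const_mul, integral_const_mul,
          integral_add (integrable_const _) (hint.div_const L), integral_div,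
          integral_sum_exp_mul_sq_stdGaussian (by norm_num), hsqrt]
        simp only [integral_const, probReal_univ, smul_eq_mul, one_mul, Fintype.card_fin]
        ring

lemma two_le_two_mul_div (hs : 0 < s) (hsn : s ≤ n) : 2 ≤ 2 * n / s := by
  rw [le_div_iff₀ hs]
  linarith

theorem gaussianMeanWidth_sparseSignalSet_sq_le (hs : 0 < s) (hsn : s ≤ n) :
    gaussianMeanWidth (sparseSignalSet n s) ^ 2 ≤
      (16 + 8 * √2 / Real.log 2) * (s * Real.log (2 * n / s)) := by
  have hn : (0 : ℝ) < n := hs.trans_le hsn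
  have hL : 2 ≤ 2 * n / s := two_le_two_mul_div hs hsn
  calc gaussianMeanWidth (sparseSignalSet n s) ^ 2
      ≤ 16 * (s * Real.log (2 * n / s) + n * √2 / (2 * n / s)) :=
        gaussianMeanWidth_sparseSignalSet_sq_le_add hs.le (one_le_two.trans hL)
    _ = 16 * (s * Real.log (2 * n / s)) + 8 * √2 / Real.log 2 * (s * Real.log 2) := by
        field_simp
        ring
    _ ≤ 16 * (s * Real.log (2 * n / s)) + 8 * √2 / Real.log 2 * (s * Real.log (2 * n / s)) := by
        gcongr
    _ = (16 + 8 * √2 / Real.log 2) * (s * Real.log (2 * n / s)) := by ring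

end UpperBound

section LowerBound

/-- The vector supported on the finite set `T` with entries `sign (g i) / √|T|` there. It has norm
at most `1` and inner product `(∑ i ∈ T, |g i|) / √|T|` with `g`; for `T = ∅` it is `0`. -/
noncomputable def normalizedSign {ι : Type*} [DecidableEq ι] (T : Finset ι)
    (g : EuclideanSpace ℝ ι) : EuclideanSpace ℝ ι :=
  WithLp.toLp 2 fun i => if i ∈ T then SignType.sign (g i) / √T.card else 0

section NormalizedSign

variable {ι : Type*} [DecidableEq ι] (T : Finset ι) (g : EuclideanSpace ℝ ι)

lemma normalizedSign_apply (i : ι) :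
    normalizedSign T g i = if i ∈ T then SignType.sign (g i) / √T.card else 0 :=
  rfl

lemma normalizedSign_neg : normalizedSign T (-g) = -normalizedSign T g := by
  ext i
  simp only [normalizedSign_apply, PiLp.neg_apply, Left.sign_neg]
  split_ifs <;> simp [neg_div]

variable [Fintype ι]

lemma hammingNorm_normalizedSign_le : hammingNorm (WithLp.ofLp (normalizedSign T g)) ≤ T.card := by
  refine Finset.card_le_card fun i hi => ?_
  by_contra hiT
  simp [normalizedSign_apply, hiT] at hi

lemma norm_normalizedSign_le_one : ‖normalizedSign T g‖ ≤ 1 := by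
  have hsign (i : ι) : (SignType.sign (g i) : ℝ) ^ 2 ≤ 1 := by
    rcases SignType.sign (g i) with _ | _ | _ <;> simp
  rw [← sq_le_one_iff₀ (norm_nonneg _), EuclideanSpace.real_norm_sq_eq]
  calc ∑ i, normalizedSign T g i ^ 2 = ∑ i ∈ T, (SignType.sign (g i) : ℝ) ^ 2 / T.card := by
        simp [normalizedSign_apply, ite_pow, div_pow]
    _ ≤ ∑ i ∈ T, 1 / (T.card : ℝ) := by
        gcongr
        exact hsign _
    _ ≤ 1 := by simpa [← div_eq_mul_inv] using div_self_le_one (T.card : ℝ)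

lemma inner_normalizedSign : inner ℝ g (normalizedSign T g) = (∑ i ∈ T, |g i|) / √T.card := by
  simp [PiLp.inner_apply, normalizedSign_apply, Finset.sum_div, div_mul_eq_mul_div]

end NormalizedSign

variable {n : ℕ} {s : ℝ}

lemma normalizedSign_mem_sparseSignalSet {T : Finset (Fin n)} (hT : T.card ≤ s)
    (g : EuclideanSpace ℝ (Fin n)) : normalizedSign T g ∈ sparseSignalSet n s :=
  ⟨(Nat.cast_le.2 (hammingNorm_normalizedSign_le T g)).trans hT, norm_normalizedSign_le_one T g⟩

lemma sum_abs_le_widthAlong_sparseSignalSet {T : Finset (Fin n)} (hT : T.card ≤ s)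
    (g : EuclideanSpace ℝ (Fin n)) :
    2 / √T.card * ∑ i ∈ T, |g i| ≤ widthAlong (sparseSignalSet n s) g := by
  have h := two_mul_inner_le_widthAlong (g := g) (sparseSignalSet_isBounded n s)
    (normalizedSign_mem_sparseSignalSet hT g)
    (normalizedSign_neg T g ▸ normalizedSign_mem_sparseSignalSet hT (-g))
  rwa [inner_normalizedSign, mul_div_left_comm, mul_comm] at h

section Blocks

variable {β κ : Type*} [Fintype β] [Fintype κ] [Nonempty κ]

lemma sum_norm_block_le_widthAlong_sparseSignalSet (e : β × κ ↪ Fin n)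
    (hs : Fintype.card β ≤ s) (g : EuclideanSpace ℝ (Fin n)) :
    2 / √(Fintype.card β) * ∑ j, ‖fun i => g (e (j, i))‖ ≤
      widthAlong (sparseSignalSet n s) g := by
  choose i hi using fun j => (IsGreatest.pi_norm fun i => g (e (j, i))).1
  let f : β ↪ Fin n := ⟨fun j => e (j, i j), fun _ _ h => congrArg Prod.fst (e.injective h)⟩
  have hf (j : β) : ‖g (f j)‖ = ‖fun i => g (e (j, i))‖ := hi j
  have h := sum_abs_le_widthAlong_sparseSignalSet (T := Finset.univ.map f) (s := s)
    (by simpa using hs) g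
  simpa only [Finset.card_map, Finset.card_univ, Finset.sum_map, ← Real.norm_eq_abs, hf] using h

lemma le_gaussianMeanWidth_sparseSignalSet (e : β × κ ↪ Fin n) (hs : Fintype.card β ≤ s) :
    2 * √(Fintype.card β) * (gaussianMaxConst * √(Real.log (2 * Fintype.card κ))) ≤
      gaussianMeanWidth (sparseSignalSet n s) := by
  have hblock (j : β) : Function.Injective fun i : κ => e (j, i) :=
    e.injective.comp (Prod.mk_right_injective j)
  have hint (j : β) : Integrable (fun g : EuclideanSpace ℝ (Fin n) => ‖fun i => g (e (j, i))‖)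
      (stdGaussian (EuclideanSpace ℝ (Fin n))) :=
    integrable_norm_comp_stdGaussian (hblock j)
  calc 2 * √(Fintype.card β) * (gaussianMaxConst * √(Real.log (2 * Fintype.card κ)))
      = 2 / √(Fintype.card β) *
          ∑ _j : β, gaussianMaxConst * √(Real.log (2 * Fintype.card κ)) := by
        rw [Finset.sum_const, Finset.card_univ, nsmul_eq_mul, ← mul_assoc (2 / _),
          div_mul_eq_mul_div, mul_div_assoc, Real.div_sqrt]
    _ ≤ 2 / √(Fintype.card β) * ∑ j, ∫ g : EuclideanSpace ℝ (Fin n), ‖fun i => g (e (j, i))‖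
          ∂(stdGaussian (EuclideanSpace ℝ (Fin n))) := by
        gcongr with j
        exact mul_sqrt_log_le_integral_norm_comp_stdGaussian (hblock j)
    _ = ∫ g : EuclideanSpace ℝ (Fin n), 2 / √(Fintype.card β) * ∑ j, ‖fun i => g (e (j, i))‖
          ∂(stdGaussian (EuclideanSpace ℝ (Fin n))) := by
        rw [integral_const_mul, integral_finsetSum _ fun j _ => hint j]
    _ ≤ gaussianMeanWidth (sparseSignalSet n s) :=
        integral_mono ((integrable_finsetSum _ fun j _ => hint j).const_mul _)
          (integrable_widthAlong (sparseSignalSet_isBounded n s))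
          (sum_norm_block_le_widthAlong_sparseSignalSet e hs)

end Blocks

lemma log_two_mul_div_le_two_mul_log {m : ℕ} (hm : 0 < m) (hms : m ≤ s) (hmn : m ≤ n) :
    Real.log (2 * n / s) ≤ 2 * Real.log (2 * (n / m : ℕ)) := by
  have hm0 : (0 : ℝ) < m := by exact_mod_cast hm
  have hn : (0 : ℝ) < n := by exact_mod_cast hm.trans_le hmn
  have hk : (1 : ℝ) ≤ (n / m : ℕ) := by exact_mod_cast Nat.div_pos hmn hm
  have hnk : (n : ℝ) / m ≤ (n / m : ℕ) + 1 := by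
    rw [div_le_iff₀' hm0]
    exact_mod_cast (Nat.lt_mul_div_succ n hm).le
  have hsq : 2 * n / s ≤ (2 * (n / m : ℕ) : ℝ) ^ 2 :=
    calc 2 * n / s ≤ 2 * (n / m) := by rw [← mul_div_assoc]; gcongr
      _ ≤ 2 * ((n / m : ℕ) + 1) := by gcongr
      _ ≤ (2 * (n / m : ℕ) : ℝ) ^ 2 := by nlinarith
  calc Real.log (2 * n / s) ≤ Real.log ((2 * (n / m : ℕ) : ℝ) ^ 2) :=
        Real.log_le_log (div_pos (by positivity) (hm0.trans_le hms)) hsq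
    _ = 2 * Real.log (2 * (n / m : ℕ)) := by rw [Real.log_pow, Nat.cast_ofNat]

theorem le_gaussianMeanWidth_sparseSignalSet_sq (hs : 1 ≤ s) (hsn : s ≤ n) :
    gaussianMaxConst ^ 2 * (s * Real.log (2 * n / s)) ≤
      gaussianMeanWidth (sparseSignalSet n s) ^ 2 := by
  set m := ⌊s⌋₊
  have hs0 : 0 ≤ s := zero_le_one.trans hs
  have hms : (m : ℝ) ≤ s := Nat.floor_le hs0
  have hm : 0 < m := Nat.floor_pos.2 hs
  have hmn : m ≤ n := Nat.floor_le_of_le hsn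
  set k := n / m
  have hk : 0 < k := Nat.div_pos hmn hm
  have : Nonempty (Fin k) := Fin.pos_iff_nonempty.1 hk
  have hlog : 0 ≤ Real.log (2 * k) := by exact_mod_cast Real.log_natCast_nonneg (2 * k)
  have hs2m : s ≤ 2 * m := by
    have : (1 : ℝ) ≤ m := by exact_mod_cast hm
    linarith [Nat.lt_floor_add_one s]
  obtain ⟨e⟩ : Nonempty (Fin m × Fin k ↪ Fin n) :=
    Function.Embedding.nonempty_of_card_le (by simpa using Nat.mul_div_le n m)
  have hwidth : 2 * √m * (gaussianMaxConst * √(Real.log (2 * k))) ≤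
      gaussianMeanWidth (sparseSignalSet n s) := by
    simpa using le_gaussianMeanWidth_sparseSignalSet e (by simpa using hms)
  calc gaussianMaxConst ^ 2 * (s * Real.log (2 * n / s))
      ≤ gaussianMaxConst ^ 2 * (2 * m * (2 * Real.log (2 * k))) := by
        gcongr ?_ * ?_
        exact mul_le_mul hs2m (log_two_mul_div_le_two_mul_log hm hms hmn)
          (Real.log_nonneg (one_le_two.trans (two_le_two_mul_div (one_pos.trans_le hs) hsn)))
          (by positivity)
    _ = (2 * √m * (gaussianMaxConst * √(Real.log (2 * k)))) ^ 2 := by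
        rw [mul_pow, mul_pow, mul_pow, Real.sq_sqrt (Nat.cast_nonneg m), Real.sq_sqrt hlog]
        ring
    _ ≤ gaussianMeanWidth (sparseSignalSet n s) ^ 2 := by
        have := gaussianMaxConst_pos
        gcongr

end LowerBound

theorem mainTheorem7 :
    ∃ c C : ℝ, 0 < c ∧ 0 < C ∧
      ∀ (n : ℕ) (s : ℝ), 0 < s → s ≤ (n : ℝ) →
        Integrable (widthAlong (sparseSignalSet n s))
            (stdGaussian (EuclideanSpace ℝ (Fin n))) ∧
        (1 ≤ s →
          c * (s * Real.log (2 * n / s)) ≤ gaussianMeanWidth (sparseSignalSet n s) ^ 2) ∧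
        gaussianMeanWidth (sparseSignalSet n s) ^ 2 ≤ C * (s * Real.log (2 * n / s)) := by
  refine ⟨gaussianMaxConst ^ 2, 16 + 8 * √2 / Real.log 2, pow_pos gaussianMaxConst_pos 2,
    by positivity, fun n s hs hsn => ⟨?_, fun hs1 => ?_, ?_⟩⟩
  · exact integrable_widthAlong (sparseSignalSet_isBounded n s)
  · exact le_gaussianMeanWidth_sparseSignalSet_sq hs1 hsn
  · exact gaussianMeanWidth_sparseSignalSet_sq_le hs hsn
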